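/- Let $b:\mathbb R^d\to\mathbb R^d$ be globally Lipschitz. Let $0$ be an asymptotically stable equilibrium of $\dot u=b(u)$, and let $D\ni 0$ be an open set with $C^1$ boundary, contained in the basin of attraction of $0$, such that $\langle b(y),n(y)\rangle<0$ for every $y\in\partial D$, where $n(y)$ is the exterior unit normal. Let $x\in\partial D$. For $T>0$ let $$\mathcal A_T=\{\phi\in H^1([0,T];\mathbb R^d):\phi(0)=0,\ \phi(T)=x\},\qquad S_T(\phi)=\tfrac12\int_0^T|\phi'-b(\phi)|^2\,dt,$$ $$V(0,x)=\inf_{T>0}\ \inf_{\phi\in\mathcal A_T}S_T(\phi).$$ For $\bar\phi\in\mathcal A_1$ put $\hat T(\bar\phi)=\|\bar\phi'\|_{L^2(0,1)}/\|b(\bar\phi)\|_{L^2(0,1)}$ and $\hat S(\bar\phi)=\frac{\hat T(\bar\phi)}2\int_0^1|\hat T(\bar\phi)^{-1}\bar\phi'-b(\bar\phi)|^2\,ds$. For an absolutely continuous path $\varphi$ on $[0,T]$ let $$\hat S_{\mathrm{geo}}(\varphi)=\int_0^T\big(|\varphi'|\,|b(\varphi)|-\langle\varphi',b(\varphi)\rangle\big)\,d\alpha,$$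 which does not depend on the parametrization. Let $N\ge 0$ and, for every integer $n\ge N$, let $\bar\phi^{*,n}\in\mathcal A_1$ be a minimizer of $\hat S$ over $\{\bar\phi\in\mathcal A_1:\hat T(\bar\phi)\le n\}$. Let $T_n=\hat T(\bar\phi^{*,n})$ and $\phi^{*,n}(t)=\bar\phi^{*,n}(t/T_n)$, $0\le t\le T_n$. Assume that the lengths $\int_0^{T_n}|(\phi^{*,n})'|\,dt$, $n\ge N$, are uniformly bounded. Then: 1. $\hat S(\bar\phi^{*,n})\to\inf_{\mathcal A_1}\hat S$ and $S_{T_n}(\phi^{*,n})\to V(0,x)$ as $n\to\infty$, i.e. the constrained minimizers form a minimizing sequence. 2. There are an absolutely continuous path $\varphi^*:[0,1]\to\mathbb R^d$ from $0$ to $x$ and a subsequence $(\phi^{*,n_l})_l$ such that $\varphi^*$ is a minimizer, in the sense that $\hat S_{\mathrm{geo}}(\varphi^*)=V(0,x)$ and $\hat S_{\mathrm{geo}}(\varphi^*)\le\hat S_{\mathrm{geo}}(\psi)$ for every $T>0$ and every absolutely continuous path $\psi$ on $[0,T]$ from $0$ to $x$, and such that $\phi^{*,n_l}\to\varphi^*$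 in Fréchet distance. Here the Fréchet distance of curves $f$ on $[0,T_1]$ and $g$ on $[0,T_2]$ is $\inf_{\alpha,\beta}\sup_{s\in[0,1]}|f(\alpha(s))-g(\beta(s))|$ over continuous nondecreasing surjections $\alpha:[0,1]\to[0,T_1]$, $\beta:[0,1]\to[0,T_2]$. -/

import Mathlib

open Set Filter Topology MeasureTheory
open scoped ENNReal NNReal

noncomputable section

namespace MinAction

/-! ### Paths, action functional, quasi-potential -/

/-- `φ` restricted to `[0, T]` is an absolutely continuous path from `x₁` to `x₂`. -/
def ACPath {d : ℕ} (x₁ x₂ : EuclideanSpace ℝ (Fin d)) (T : ℝ)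
    (φ : ℝ → EuclideanSpace ℝ (Fin d)) : Prop :=
  AbsolutelyContinuousOnInterval φ 0 T ∧ φ 0 = x₁ ∧ φ T = x₂

/-- The admissible set: paths in `H¹((0, T); ℝᵈ)` from `x₁` to `x₂`. In one dimension, an `H¹`
function is (the continuous representative of) an absolutely continuous function whose
derivative is square integrable. -/
def admissible {d : ℕ} (x₁ x₂ : EuclideanSpace ℝ (Fin d)) (T : ℝ) :
    Set (ℝ → EuclideanSpace ℝ (Fin d)) :=
  {φ | ACPath x₁ x₂ T φ ∧ MemLp (deriv φ) 2 (volume.restrict (Icc 0 T))}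

/-- The action functional `S_T(φ) = ½ ∫₀ᵀ |φ' - b(φ)|² dt`. -/
def action {d : ℕ} (b : EuclideanSpace ℝ (Fin d) → EuclideanSpace ℝ (Fin d)) (T : ℝ)
    (φ : ℝ → EuclideanSpace ℝ (Fin d)) : ℝ :=
  (1 / 2) * ∫ t in (0 : ℝ)..T, ‖deriv φ t - b (φ t)‖ ^ 2

/-- The quasi-potential `V(x₁, x₂)`, the value of
`inf_{T > 0} inf {S_T(φ) : φ(0) = x₁, φ(T) = x₂}`. Absolutely continuous paths that are not
in `H¹` have infinite action, so the infimum runs over `H¹` paths. -/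
def quasiPotential {d : ℕ} (b : EuclideanSpace ℝ (Fin d) → EuclideanSpace ℝ (Fin d))
    (x₁ x₂ : EuclideanSpace ℝ (Fin d)) : ℝ :=
  sInf {s : ℝ | ∃ T : ℝ, 0 < T ∧ ∃ φ ∈ admissible x₁ x₂ T, s = action b T φ}

/-! ### Linear time scaling -/

/-- The rescaled action on `[0, 1]`: `S(T, φ) = (T/2) ∫₀¹ |T⁻¹ φ' - b(φ)|² ds`. -/
def scaledAction {d : ℕ} (b : EuclideanSpace ℝ (Fin d) → EuclideanSpace ℝ (Fin d)) (T : ℝ)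
    (φ : ℝ → EuclideanSpace ℝ (Fin d)) : ℝ :=
  (T / 2) * ∫ s in (0 : ℝ)..1, ‖T⁻¹ • deriv φ s - b (φ s)‖ ^ 2

/-- The optimal linear time scale: the quotient of the `L²(0, 1)` norms of `φ'` and `b(φ)`. -/
def optTime {d : ℕ} (b : EuclideanSpace ℝ (Fin d) → EuclideanSpace ℝ (Fin d))
    (φ : ℝ → EuclideanSpace ℝ (Fin d)) : ℝ :=
  Real.sqrt (∫ s in (0 : ℝ)..1, ‖deriv φ s‖ ^ 2) /
    Real.sqrt (∫ s in (0 : ℝ)..1, ‖b (φ s)‖ ^ 2)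

/-- The reformulated action `Ŝ(φ) = S(T̂(φ), φ)`. -/
def optAction {d : ℕ} (b : EuclideanSpace ℝ (Fin d) → EuclideanSpace ℝ (Fin d))
    (φ : ℝ → EuclideanSpace ℝ (Fin d)) : ℝ :=
  scaledAction b (optTime b φ) φ

/-- `φ` minimizes `Ŝ` over the admissible paths on `[0, 1]` subject to `T̂ ≤ n`. -/
def IsConstrainedMinimizer {d : ℕ}
    (b : EuclideanSpace ℝ (Fin d) → EuclideanSpace ℝ (Fin d))
    (x₁ x₂ : EuclideanSpace ℝ (Fin d)) (n : ℕ) (φ : ℝ → EuclideanSpace ℝ (Fin d)) : Prop :=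
  φ ∈ admissible x₁ x₂ 1 ∧ optTime b φ ≤ n ∧
    ∀ ψ ∈ admissible x₁ x₂ 1, optTime b ψ ≤ n → optAction b φ ≤ optAction b ψ

/-- The path in physical time, `t ↦ φ(t / T̂(φ))` on `[0, T̂(φ)]`, of a path `φ` on `[0, 1]`. -/
def timePath {d : ℕ} (b : EuclideanSpace ℝ (Fin d) → EuclideanSpace ℝ (Fin d))
    (φ : ℝ → EuclideanSpace ℝ (Fin d)) : ℝ → EuclideanSpace ℝ (Fin d) :=
  fun t => φ (t / optTime b φ)

/-! ### Geometry of curves -/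

/-- The length `∫₀ᵀ |φ'(t)| dt` of the curve `φ` on `[0, T]`. -/
def curveLength {d : ℕ} (T : ℝ) (φ : ℝ → EuclideanSpace ℝ (Fin d)) : ℝ :=
  ∫ t in (0 : ℝ)..T, ‖deriv φ t‖

/-- The geometric (parametrization invariant) action `∫₀ᵀ (|φ'| |b(φ)| - ⟨φ', b(φ)⟩) dα`. -/
def geomAction {d : ℕ} (b : EuclideanSpace ℝ (Fin d) → EuclideanSpace ℝ (Fin d)) (T : ℝ)
    (φ : ℝ → EuclideanSpace ℝ (Fin d)) : ℝ :=
  ∫ α in (0 : ℝ)..T, (‖deriv φ α‖ * ‖b (φ α)‖ - inner ℝ (deriv φ α) (b (φ α)))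

/-- Continuous nondecreasing maps of `[0, 1]` onto `[0, T]`. -/
def reparam (T : ℝ) : Set (ℝ → ℝ) :=
  {α | ContinuousOn α (Icc 0 1) ∧ MonotoneOn α (Icc 0 1) ∧ α 0 = 0 ∧ α 1 = T}

/-- The Fréchet distance between the curves `f` on `[0, T₁]` and `g` on `[0, T₂]`. -/
def frechetDist {d : ℕ} (T₁ : ℝ) (f : ℝ → EuclideanSpace ℝ (Fin d)) (T₂ : ℝ)
    (g : ℝ → EuclideanSpace ℝ (Fin d)) : ℝ≥0∞ :=
  ⨅ α ∈ reparam T₁, ⨅ β ∈ reparam T₂, ⨆ s ∈ Icc (0 : ℝ) 1, edist (f (α s)) (g (β s))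

/-! ### The exit problem -/

/-- The basin of attraction of `p` for `du/dt = b(u)`. -/
def basin {d : ℕ} (b : EuclideanSpace ℝ (Fin d) → EuclideanSpace ℝ (Fin d))
    (p : EuclideanSpace ℝ (Fin d)) : Set (EuclideanSpace ℝ (Fin d)) :=
  {y | ∃ u : ℝ → EuclideanSpace ℝ (Fin d),
    IsIntegralCurveOn u (fun _ => b) (Ici 0) ∧ u 0 = y ∧ Tendsto u atTop (𝓝 p)}

/-- `p` is an asymptotically stable equilibrium of `du/dt = b(u)`: an equilibrium that is
Lyapunov stable and attracts a neighbourhood. -/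
def IsAsymptoticallyStable {d : ℕ}
    (b : EuclideanSpace ℝ (Fin d) → EuclideanSpace ℝ (Fin d))
    (p : EuclideanSpace ℝ (Fin d)) : Prop :=
  b p = 0 ∧
  (∀ ε > 0, ∃ δ > 0, ∀ u : ℝ → EuclideanSpace ℝ (Fin d),
    IsIntegralCurveOn u (fun _ => b) (Ici 0) → dist (u 0) p < δ →
      ∀ t, 0 ≤ t → dist (u t) p < ε) ∧
  basin b p ∈ 𝓝 p

/-- `ν` is the exterior unit normal at `y` of a set `D` that near `y` is the sublevel set
`{ρ < 0}` of a `C¹` function `ρ` with nonvanishing gradient at `y`. -/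
def IsExteriorNormal {d : ℕ} (D : Set (EuclideanSpace ℝ (Fin d)))
    (y ν : EuclideanSpace ℝ (Fin d)) : Prop :=
  ∃ (U : Set (EuclideanSpace ℝ (Fin d))) (ρ : EuclideanSpace ℝ (Fin d) → ℝ),
    IsOpen U ∧ y ∈ U ∧ ContDiffOn ℝ 1 ρ U ∧ D ∩ U = {z ∈ U | ρ z < 0} ∧
    gradient ρ y ≠ 0 ∧ ν = ‖gradient ρ y‖⁻¹ • gradient ρ y

/-- `D` is the domain of an exit problem from the equilibrium `0`: an open set containing `0`,
contained in the basin of attraction of the asymptotically stable equilibrium `0`, with a `C¹`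
boundary along which `b` points strictly into `D`. -/
structure IsExitDomain {d : ℕ} (b : EuclideanSpace ℝ (Fin d) → EuclideanSpace ℝ (Fin d))
    (D : Set (EuclideanSpace ℝ (Fin d))) : Prop where
  isOpen : IsOpen D
  zero_mem : (0 : EuclideanSpace ℝ (Fin d)) ∈ D
  stable : IsAsymptoticallyStable b 0
  subset_basin : D ⊆ basin b 0
  inward : ∀ y ∈ frontier D, ∃ ν, IsExteriorNormal D y ν ∧ inner ℝ (b y) ν < 0

end MinAction

end

namespace MinAction

variable {d : ℕ}

local notation "𝔼" d => EuclideanSpace ℝ (Fin d)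

/-! ### Absolutely continuous curves -/

/-! For a path on `[0, 1]` put A = ∫|φ'|², B = ∫|b(φ)|², C = ∫⟨φ', b(φ)⟩. Its action when run in
time T is (A/T + TB)/2 - C. By AM-GM this is smallest at T = √A/√B, which is T̂, with value Ŝ = √A√B
- C. Hence inf Ŝ = V, and since every admissible path satisfies T̂ ≤ n for large n, the constrained
minimizers are a minimizing sequence. The exit domain supplies x ≠ 0 and b(x) ≠ 0, which make A and
B positive.

The limit is compared through the geometric action. Cauchy–Schwarz gives Ŝ_geo ≤ Ŝ. Conversely V ≤
Ŝ_geo on every absolutely continuous path (`quasiPotential_le_geomAction`): running the path at a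
speed close to |b| yields an H¹ path whose action exceeds Ŝ_geo arbitrarily little.

Bounded length permits reparametrization to equi-Lipschitz curves on `[0, 1]` with the same Ŝ_geo.
By Arzelà–Ascoli a subsequence converges uniformly to some g, and Ŝ_geo is lower semicontinuous
there (`geomAction_le_of_tendsto`), so V ≤ Ŝ_geo(g) ≤ lim Ŝ = V. Uniform convergence after
reparametrization is Fréchet convergence. -/

theorem _root_.AbsolutelyContinuousOnInterval.coord {f : ℝ → 𝔼 d} {a b : ℝ}
    (hf : AbsolutelyContinuousOnInterval f a b) (i : Fin d) :
    AbsolutelyContinuousOnInterval (fun t => f t i) a b := by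
  refine squeeze_zero (fun E => Finset.sum_nonneg fun _ _ => dist_nonneg) (fun E => ?_) hf
  refine Finset.sum_le_sum fun j _ => ?_
  rw [Real.dist_eq, dist_eq_norm, ← Real.norm_eq_abs, ← PiLp.sub_apply]
  exact PiLp.norm_apply_le _ i

theorem _root_.AbsolutelyContinuousOnInterval.ae_hasDerivAt {f : ℝ → 𝔼 d} {a b : ℝ}
    (hf : AbsolutelyContinuousOnInterval f a b) :
    ∀ᵐ t, t ∈ uIcc a b → HasDerivAt f (deriv f t) t := by
  filter_upwards [hf.boundedVariationOn.ae_differentiableAt_of_mem_uIcc] with t ht h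
  exact (ht h).hasDerivAt

theorem _root_.HasDerivAt.coord {f : ℝ → 𝔼 d} {f' : 𝔼 d} {t : ℝ} (h : HasDerivAt f f' t)
    (i : Fin d) : HasDerivAt (fun s => f s i) (f' i) t :=
  (EuclideanSpace.proj i : (𝔼 d) →L[ℝ] ℝ).hasFDerivAt.comp_hasDerivAt t h

theorem _root_.AbsolutelyContinuousOnInterval.ae_deriv_coord {f : ℝ → 𝔼 d} {a b : ℝ}
    (hf : AbsolutelyContinuousOnInterval f a b) (i : Fin d) :
    ∀ᵐ t, t ∈ uIcc a b → deriv (fun s => f s i) t = deriv f t i := by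
  filter_upwards [hf.ae_hasDerivAt] with t ht h
  exact ((ht h).coord i).deriv

/-- Reduces to the scalar theory: the Euclidean norm is at most the sum of the absolute values of
the coordinates. -/
theorem intervalIntegrable_deriv {f : ℝ → 𝔼 d} {a b : ℝ}
    (hf : AbsolutelyContinuousOnInterval f a b) :
    IntervalIntegrable (deriv f) volume a b := by
  have h (i : Fin d) : IntervalIntegrable (fun t => deriv f t i) volume a b := by
    refine (hf.coord i).intervalIntegrable_deriv.congr_ae ?_
    rw [Filter.EventuallyEq, ae_restrict_iff' measurableSet_uIoc]
    filter_upwards [hf.ae_deriv_coord i] with t ht hmem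
    exact ht (uIoc_subset_uIcc hmem)
  have hs : IntervalIntegrable (fun t => ∑ i, ‖deriv f t i‖) volume a b := by
    have := IntervalIntegrable.sum (Finset.univ) fun i _ => (h i).norm
    convert! this using 1
    ext t; simp
  refine hs.mono_fun (measurable_deriv f).aestronglyMeasurable ?_
  refine Eventually.of_forall fun t => ?_
  have h0 : 0 ≤ ∑ i, ‖deriv f t i‖ := Finset.sum_nonneg fun _ _ => norm_nonneg _
  show ‖deriv f t‖ ≤ ‖∑ i, ‖deriv f t i‖‖
  rw [Real.norm_of_nonneg h0, EuclideanSpace.norm_eq, Real.sqrt_le_left h0]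
  exact Finset.sum_sq_le_sq_sum_of_nonneg fun _ _ => norm_nonneg _

theorem integral_deriv_eq_sub {f : ℝ → 𝔼 d} {a b : ℝ}
    (hf : AbsolutelyContinuousOnInterval f a b) :
    ∫ t in a..b, deriv f t = f b - f a := by
  ext i
  have h1 := (EuclideanSpace.proj i : (𝔼 d) →L[ℝ] ℝ).intervalIntegral_comp_comm
    (intervalIntegrable_deriv hf)
  have h2 := (hf.coord i).integral_deriv_eq_sub
  rw [PiLp.sub_apply, ← h2]
  refine Eq.trans h1.symm (intervalIntegral.integral_congr_ae ?_)
  filter_upwards [hf.ae_deriv_coord i] with t ht hmem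
  exact (ht (uIoc_subset_uIcc hmem)).symm

theorem norm_sub_le_integral_norm_deriv {f : ℝ → 𝔼 d} {a b : ℝ} (hab : a ≤ b)
    (hf : AbsolutelyContinuousOnInterval f a b) :
    ‖f b - f a‖ ≤ ∫ t in a..b, ‖deriv f t‖ := by
  rw [← integral_deriv_eq_sub hf]
  exact intervalIntegral.norm_integral_le_integral_norm hab

theorem _root_.AbsolutelyContinuousOnInterval.comp_mul_left {f : ℝ → 𝔼 d} {c T S : ℝ}
    (hc : 0 < c) (hT : c * S = T) (hf : AbsolutelyContinuousOnInterval f 0 T) :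
    AbsolutelyContinuousOnInterval (fun s => f (c * s)) 0 S := by
  subst hT
  rw [absolutelyContinuousOnInterval_iff] at hf ⊢
  have hsc (u v : ℝ) : uIcc (c * u) (c * v) = (fun x => c * x) '' uIcc u v := by
    simp
  intro ε hε
  obtain ⟨δ, hδ, h⟩ := hf ε hε
  refine ⟨δ / c, by positivity, fun E hE hsum => ?_⟩
  refine h (E.1, fun i => (c * (E.2 i).1, c * (E.2 i).2)) ⟨fun i hi => ?_, fun i hi j hj hij => ?_⟩ ?_
  · have := hE.1 i hi
    rw [show (0 : ℝ) = c * 0 by simp, hsc]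
    exact ⟨mem_image_of_mem _ this.1, mem_image_of_mem _ this.2⟩
  · have := hE.2 hi hj hij
    simp only [Function.onFun, Set.disjoint_left, mem_uIoc] at this ⊢
    intro z hz hz'
    have hz1 : c * (z / c) = z := by field_simp
    rw [← hz1] at hz hz'
    simp only [mul_lt_mul_iff_right₀ hc, mul_le_mul_iff_right₀ hc] at hz hz'
    exact this hz hz'
  · simp only [Real.dist_eq, ← mul_sub, abs_mul, abs_of_pos hc, ← Finset.mul_sum] at hsum ⊢
    rwa [lt_div_iff₀' hc] at hsum

/-! ### Time changes -/

/-- The primitive has slope at least δ, so it is strictly increasing and unbounded in both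
directions. -/
theorem exists_orderIso_eq_integral {w : ℝ → ℝ} (hw : ∀ a b, IntervalIntegrable w volume a b)
    {δ : ℝ} (hδ : 0 < δ) (hwδ : ∀ s, δ ≤ w s) :
    ∃ e : ℝ ≃o ℝ, ∀ s, e s = ∫ r in (0 : ℝ)..s, w r := by
  set t : ℝ → ℝ := fun s => ∫ r in (0 : ℝ)..s, w r with ht
  have hlow (a b : ℝ) (hab : a ≤ b) : δ * (b - a) ≤ t b - t a := by
    have h1 : t b - t a = ∫ r in a..b, w r :=
      intervalIntegral.integral_interval_sub_left (hw _ _) (hw _ _)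
    have h2 : ∫ r in a..b, δ ≤ ∫ r in a..b, w r :=
      intervalIntegral.integral_mono_on hab (by simp) (hw _ _) fun s _ => hwδ s
    rw [intervalIntegral.integral_const, smul_eq_mul] at h2
    linarith
  have h0 : t 0 = 0 := by simp [ht]
  have hmono : StrictMono t := fun a b hab => by
    have := hlow a b hab.le
    have := mul_pos hδ (sub_pos.2 hab)
    linarith
  have hsurj : Function.Surjective t := by
    refine (intervalIntegral.continuous_primitive hw 0).surjective ?_ ?_
    · refine tendsto_atTop_mono' _ ?_ (tendsto_id.const_mul_atTop hδ)
      filter_upwards [eventually_ge_atTop 0] with s hs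
      have := hlow 0 s hs
      simp only [h0, sub_zero] at this
      exact this
    · refine tendsto_atBot_mono' _ ?_ (tendsto_id.const_mul_atBot hδ)
      filter_upwards [eventually_le_atBot 0] with s hs
      have := hlow s 0 hs
      show t s ≤ δ * s
      linarith
  exact ⟨hmono.orderIsoOfSurjective t hsurj, fun s => rfl⟩

/-- Change of variables on the set G of points where both e and φ have their expected derivatives. G
has full measure in the domain, and e(G) has full measure in the target because its measure is ∫_G w
= e(S). No integrability of F is needed. -/
theorem integral_timeChange {φ : ℝ → 𝔼 d} {S : ℝ} (hS : 0 < S)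
    (hφ : AbsolutelyContinuousOnInterval φ 0 S) {w : ℝ → ℝ}
    (hw : ∀ a b, IntervalIntegrable w volume a b) (hw0 : ∀ s, 0 < w s)
    {e : ℝ ≃o ℝ} (he : ∀ s, e s = ∫ r in (0 : ℝ)..s, w r) (F : (𝔼 d) → (𝔼 d) → ℝ) :
    ∫ t in (0 : ℝ)..e S, F (φ (e.symm t)) (deriv (φ ∘ e.symm) t) =
      ∫ s in (0 : ℝ)..S, w s * F (φ s) ((w s)⁻¹ • deriv φ s) := by
  have he0 : e 0 = 0 := by simp [he]
  have hloc : LocallyIntegrable w volume := by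
    refine (locallyIntegrable_iff).2 fun K hK => ?_
    obtain ⟨a, ha⟩ := hK.bddBelow
    obtain ⟨c, hc⟩ := hK.bddAbove
    by_cases hac : a ≤ c
    · exact ((intervalIntegrable_iff_integrableOn_Icc_of_le hac).1 (hw a c)).mono_set
        fun z hz => ⟨ha hz, hc hz⟩
    · have : K = ∅ := eq_empty_of_forall_notMem fun z hz => hac ((ha hz).trans (hc hz))
      simp [this]
  have hgood : ∀ᵐ s, HasDerivAt e (w s) s ∧ (s ∈ uIcc 0 S → HasDerivAt φ (deriv φ s) s) := by
    filter_upwards [_root_.LocallyIntegrable.ae_hasDerivAt_integral hloc, hφ.ae_hasDerivAt] with s hs hs'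
    exact ⟨(hs 0).congr_of_eventuallyEq (Eventually.of_forall he), hs'⟩
  set P : Set ℝ := {s | HasDerivAt e (w s) s ∧ (s ∈ uIcc 0 S → HasDerivAt φ (deriv φ s) s)}
  -- A measurable null superset of the bad points, so that G is measurable.
  set N : Set ℝ := toMeasurable volume Pᶜ with hN
  have hN0 : volume N = 0 := by rw [hN, measure_toMeasurable]; exact hgood
  set G : Set ℝ := Ioo 0 S \ N with hG
  have hGm : MeasurableSet G := measurableSet_Ioo.diff (measurableSet_toMeasurable _ _)
  have hGP : ∀ s ∈ G, s ∈ P := fun s hs => by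
    by_contra h
    exact hs.2 (subset_toMeasurable _ _ h)
  have hGae : G =ᵐ[volume] Ioc 0 S :=
    (sdiff_null_ae_eq_self hN0).trans Ioo_ae_eq_Ioc
  have hder : ∀ s ∈ G, HasDerivWithinAt e (w s) G s := fun s hs => (hGP s hs).1.hasDerivWithinAt
  have hpos : 0 < e S := by rw [← he0]; exact e.strictMono hS
  have hsub : e '' G ⊆ Ioc 0 (e S) := by
    rintro _ ⟨s, hs, rfl⟩
    refine ⟨?_, e.monotone hs.1.2.le⟩
    rw [← he0]; exact e.strictMono hs.1.1
  have himm : MeasurableSet (e '' G) :=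
    e.toHomeomorph.measurableEmbedding.measurableSet_image.2 hGm
  -- The image formula applied to the constant 1 computes the measure of e(G).
  have hvol : (volume (e '' G)).toReal = e S := by
    have h := integral_image_eq_integral_abs_deriv_smul hGm hder e.injective.injOn
      (fun _ => (1 : ℝ))
    rw [setIntegral_const, smul_eq_mul, mul_one] at h
    rw [← measureReal_def, h, setIntegral_congr_set hGae, he S,
      intervalIntegral.integral_of_le hS.le]
    refine setIntegral_congr_fun measurableSet_Ioc fun s _ => ?_
    simp [abs_of_pos (hw0 s)]
  have himae : e '' G =ᵐ[volume] Ioc 0 (e S) := by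
    refine ae_eq_of_subset_of_measure_ge hsub ?_ himm.nullMeasurableSet (by simp)
    rw [Real.volume_Ioc, sub_zero, ← hvol, ENNReal.ofReal_toReal]
    exact ((measure_mono hsub).trans_lt (by simp)).ne
  rw [intervalIntegral.integral_of_le hpos.le, intervalIntegral.integral_of_le hS.le,
    ← setIntegral_congr_set himae, ← setIntegral_congr_set hGae,
    integral_image_eq_integral_abs_deriv_smul hGm hder e.injective.injOn]
  refine setIntegral_congr_fun hGm fun s hs => ?_
  have h1 : HasDerivAt e.symm (w s)⁻¹ (e s) := by
    refine HasDerivAt.of_local_left_inverse (f := e) e.symm.continuous.continuousAt ?_ (hw0 s).ne'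
      (Eventually.of_forall fun y => e.apply_symm_apply y)
    rw [e.symm_apply_apply]
    exact (hGP s hs).1
  have h2 : HasDerivAt φ (deriv φ s) (e.symm (e s)) := by
    rw [e.symm_apply_apply]
    refine (hGP s hs).2 ?_
    rw [uIcc_of_le hS.le]
    exact Ioo_subset_Icc_self hs.1
  have h3 := (h2.scomp (e s) h1).deriv
  simp only [h3, e.symm_apply_apply, abs_of_pos (hw0 s), smul_eq_mul]

/-- Reparametrizing an absolutely continuous curve by `t(s) = ∫₀ˢ w`. -/
theorem exists_timeChange {φ : ℝ → 𝔼 d} {S : ℝ} (hS : 0 < S)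
    (hφ : AbsolutelyContinuousOnInterval φ 0 S) {w : ℝ → ℝ}
    (hw : IntervalIntegrable w volume 0 S) {δ : ℝ} (hδ : 0 < δ) (hwδ : ∀ s, δ ≤ w s)
    {C : ℝ≥0} (hC : ∀ s, ‖deriv φ s‖ ≤ C * w s) :
    ∃ e : ℝ ≃o ℝ, e 0 = 0 ∧ e S = ∫ r in (0 : ℝ)..S, w r ∧
      LipschitzOnWith C (φ ∘ e.symm) (Icc 0 (e S)) ∧
      ∀ F : (𝔼 d) → (𝔼 d) → ℝ,
        ∫ t in (0 : ℝ)..e S, F (φ (e.symm t)) (deriv (φ ∘ e.symm) t) =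
          ∫ s in (0 : ℝ)..S, w s * F (φ s) ((w s)⁻¹ • deriv φ s) := by
  classical
  -- Extending w by δ outside (0, S] makes its primitive a bijection of the whole line.
  set v : ℝ → ℝ := fun s => if s ∈ Ioc 0 S then w s else δ with hv
  have hvw : ∀ s ∈ Ioc 0 S, v s = w s := fun s hs => if_pos hs
  have hvδ : ∀ s, δ ≤ v s := fun s => by
    by_cases hs : s ∈ Ioc 0 S
    · rw [hvw s hs]; exact hwδ s
    · exact (if_neg hs).ge
  have hvi : ∀ a b, IntervalIntegrable v volume a b := fun a b => by
    have h1 : v = fun s => (Ioc 0 S).indicator (fun s => w s - δ) s + δ := by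
      ext s
      by_cases hs : s ∈ Ioc 0 S
      · rw [hvw s hs, indicator_of_mem hs, sub_add_cancel]
      · rw [indicator_of_notMem hs, zero_add]; exact if_neg hs
    rw [h1]
    refine IntervalIntegrable.add ?_ (by simp)
    have h2 : IntegrableOn (fun s => w s - δ) (Ioc 0 S) := by
      have := hw.sub (intervalIntegrable_const (c := δ))
      exact (intervalIntegrable_iff_integrableOn_Ioc_of_le hS.le).1 this
    exact (h2.integrable_indicator measurableSet_Ioc).intervalIntegrable
  obtain ⟨e, he⟩ := exists_orderIso_eq_integral hvi hδ hvδ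
  have he0 : e 0 = 0 := by simp [he]
  have heS : e S = ∫ r in (0 : ℝ)..S, w r := by
    rw [he, intervalIntegral.integral_of_le hS.le, intervalIntegral.integral_of_le hS.le]
    exact setIntegral_congr_fun measurableSet_Ioc hvw
  refine ⟨e, he0, heS, ?_, fun F => ?_⟩
  · have key : ∀ a b, 0 ≤ a → a ≤ b → b ≤ S → ‖φ b - φ a‖ ≤ C * (e b - e a) := by
      intro a b ha hab hb
      have hac : AbsolutelyContinuousOnInterval φ a b := hφ.mono (by
        rw [uIcc_of_le hab, uIcc_of_le hS.le]; exact Icc_subset_Icc ha hb)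
      refine (norm_sub_le_integral_norm_deriv hab hac).trans ?_
      rw [he, he, intervalIntegral.integral_interval_sub_left (hvi _ _) (hvi _ _),
        ← intervalIntegral.integral_const_mul]
      refine intervalIntegral.integral_mono_on_of_le_Ioo hab (intervalIntegrable_deriv hac).norm
        ((hvi _ _).const_mul _) fun s hs => ?_
      rw [hvw s ⟨ha.trans_lt hs.1, hs.2.le.trans hb⟩]
      exact hC s
    have key2 : ∀ p q, 0 ≤ p → p ≤ q → q ≤ e S →
        dist ((φ ∘ e.symm) p) ((φ ∘ e.symm) q) ≤ C * dist p q := by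
      intro p q hp hpq hq
      have h := key (e.symm p) (e.symm q) (by rwa [e.le_symm_apply, he0]) (e.symm.monotone hpq)
        (by rwa [e.symm_apply_le])
      rw [e.apply_symm_apply, e.apply_symm_apply] at h
      rw [dist_comm p q, Real.dist_eq, abs_of_nonneg (sub_nonneg.2 hpq), dist_comm, dist_eq_norm]
      exact h
    refine LipschitzOnWith.of_dist_le_mul fun p hp q hq => ?_
    rcases le_total p q with hpq | hpq
    · exact key2 p q hp.1 hpq hq.2
    · rw [dist_comm, dist_comm p q]
      exact key2 q p hq.1 hpq hp.2
  · rw [integral_timeChange hS hφ hvi (fun s => hδ.trans_le (hvδ s)) he F,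
      intervalIntegral.integral_of_le hS.le, intervalIntegral.integral_of_le hS.le]
    refine setIntegral_congr_fun measurableSet_Ioc fun s hs => ?_
    simp only [hvw s hs]

/-! ### The quasi-potential is a lower bound of the geometric action -/

theorem action_nonneg (b : (𝔼 d) → 𝔼 d) {T : ℝ} (hT : 0 ≤ T) (φ : ℝ → 𝔼 d) :
    0 ≤ action b T φ :=
  mul_nonneg (by norm_num) (intervalIntegral.integral_nonneg hT fun _ _ => by positivity)

theorem quasiPotential_le_action (b : (𝔼 d) → 𝔼 d) {x₁ x₂ : 𝔼 d} {T : ℝ} (hT : 0 < T)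
    {φ : ℝ → 𝔼 d} (hφ : φ ∈ admissible x₁ x₂ T) : quasiPotential b x₁ x₂ ≤ action b T φ := by
  refine csInf_le ⟨0, ?_⟩ ⟨T, hT, φ, hφ, rfl⟩
  rintro _ ⟨T', hT', φ', -, rfl⟩
  exact action_nonneg b hT'.le φ'

theorem norm_deriv_le_of_lipschitzOnWith {φ : ℝ → 𝔼 d} {C : ℝ≥0} {T : ℝ}
    (hφ : LipschitzOnWith C φ (Icc 0 T)) {t : ℝ} (ht : t ∈ Ioo 0 T) : ‖deriv φ t‖ ≤ C :=
  norm_deriv_le_of_lipschitzOn (Icc_mem_nhds ht.1 ht.2) hφ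

theorem memLp_deriv_of_lipschitzOnWith {φ : ℝ → 𝔼 d} {C : ℝ≥0} {T : ℝ}
    (hφ : LipschitzOnWith C φ (Icc 0 T)) :
    MemLp (deriv φ) 2 (volume.restrict (Icc 0 T)) := by
  refine MemLp.of_bound (measurable_deriv φ).aestronglyMeasurable C ?_
  rw [← restrict_Ioo_eq_restrict_Icc, ae_restrict_iff' measurableSet_Ioo]
  exact Eventually.of_forall fun t ht => norm_deriv_le_of_lipschitzOnWith hφ ht

theorem mem_admissible_of_lipschitzOnWith {φ : ℝ → 𝔼 d} {C : ℝ≥0} {T : ℝ} (hT : 0 ≤ T)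
    (hφ : LipschitzOnWith C φ (Icc 0 T)) : φ ∈ admissible (φ 0) (φ T) T :=
  ⟨⟨LipschitzOnWith.absolutelyContinuousOnInterval (by rwa [uIcc_of_le hT]), rfl, rfl⟩,
    memLp_deriv_of_lipschitzOnWith hφ⟩

theorem continuousOn_comp_of_ac {b : (𝔼 d) → 𝔼 d} (hb : Continuous b) {T : ℝ} {ψ : ℝ → 𝔼 d}
    (hψ : AbsolutelyContinuousOnInterval ψ 0 T) : ContinuousOn (fun s => b (ψ s)) (uIcc 0 T) :=
  hb.comp_continuousOn hψ.continuousOn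

theorem intervalIntegrable_geomAction {b : (𝔼 d) → 𝔼 d} (hb : Continuous b) {T : ℝ}
    {ψ : ℝ → 𝔼 d} (hψ : AbsolutelyContinuousOnInterval ψ 0 T) :
    IntervalIntegrable (fun s => ‖deriv ψ s‖ * ‖b (ψ s)‖ - inner ℝ (deriv ψ s) (b (ψ s)))
      volume 0 T := by
  have h1 := intervalIntegrable_deriv hψ
  have h2 := continuousOn_comp_of_ac hb hψ
  have h3 := h1.norm.mul_continuousOn h2.norm
  refine h3.sub (h3.mono_fun ?_ (Eventually.of_forall fun s => ?_))
  · exact (measurable_deriv ψ).aestronglyMeasurable.inner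
      ((h2.mono uIoc_subset_uIcc).aestronglyMeasurable measurableSet_uIoc)
  · beta_reduce
    rw [Real.norm_of_nonneg (mul_nonneg (norm_nonneg (deriv ψ s)) (norm_nonneg (b (ψ s))))]
    exact norm_inner_le_norm _ _

/-- With the clock rate w = |v|/|y| the left side would equal 2(|v||y| - ⟨v, y⟩). The regularization
by δ and ε keeps w positive and finite, at the price of the last two terms. -/
theorem timeChange_integrand_le (v y : 𝔼 d) {δ ε : ℝ} (hδ : 0 < δ) (hε : 0 < ε) :
    (‖v‖ + δ) / (‖y‖ + ε) * ‖((‖v‖ + δ) / (‖y‖ + ε))⁻¹ • v - y‖ ^ 2 ≤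
      2 * (‖v‖ * ‖y‖ - inner ℝ v y) + ε * ‖v‖ + δ * ‖y‖ := by
  have hv := norm_nonneg v
  have hy := norm_nonneg y
  have h1 : ‖v‖ ^ 2 * (‖y‖ + ε) / (‖v‖ + δ) ≤ ‖v‖ * (‖y‖ + ε) := by
    rw [div_le_iff₀ (by positivity)]
    have : 0 ≤ ‖v‖ * (‖y‖ + ε) * δ := by positivity
    nlinarith
  have h2 : (‖v‖ + δ) / (‖y‖ + ε) * ‖y‖ ^ 2 ≤ (‖v‖ + δ) * ‖y‖ := by
    rw [div_mul_eq_mul_div, div_le_iff₀ (by positivity)]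
    have : 0 ≤ (‖v‖ + δ) * ‖y‖ * ε := by positivity
    nlinarith
  have h3 : (‖v‖ + δ) / (‖y‖ + ε) * ‖((‖v‖ + δ) / (‖y‖ + ε))⁻¹ • v - y‖ ^ 2 =
      ‖v‖ ^ 2 * (‖y‖ + ε) / (‖v‖ + δ) - 2 * inner ℝ v y
        + (‖v‖ + δ) / (‖y‖ + ε) * ‖y‖ ^ 2 := by
    rw [@norm_sub_sq_real, norm_smul, real_inner_smul_left, norm_inv, norm_div,
      Real.norm_of_nonneg (by positivity : 0 ≤ ‖v‖ + δ),
      Real.norm_of_nonneg (by positivity : 0 ≤ ‖y‖ + ε)]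
    field_simp
  rw [h3]
  linarith

/-- The clock of `timeChange_integrand_le` runs ψ at speed at most |b| + ε. The new path is
therefore Lipschitz, hence in H¹, even when ψ is not. -/
theorem quasiPotential_le_geomAction {b : (𝔼 d) → 𝔼 d} (hb : Continuous b) {x₁ x₂ : 𝔼 d}
    {T : ℝ} (hT : 0 < T) {ψ : ℝ → 𝔼 d} (hψ : ACPath x₁ x₂ T ψ) :
    quasiPotential b x₁ x₂ ≤ geomAction b T ψ := by
  obtain ⟨hac, h0, h1⟩ := hψ
  have hder := intervalIntegrable_deriv hac
  have hcont := continuousOn_comp_of_ac hb hac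
  obtain ⟨B, hB⟩ := isCompact_uIcc.exists_bound_of_continuousOn hcont
  rw [uIcc_of_le hT.le] at hB
  have hB0 : 0 ≤ B := (norm_nonneg _).trans (hB 0 ⟨le_rfl, hT.le⟩)
  set P := ∫ s in (0 : ℝ)..T, ‖deriv ψ s‖ with hP
  set Q := ∫ s in (0 : ℝ)..T, ‖b (ψ s)‖ with hQ
  have hP0 : 0 ≤ P := intervalIntegral.integral_nonneg hT.le fun _ _ => norm_nonneg _
  have hQ0 : 0 ≤ Q := intervalIntegral.integral_nonneg hT.le fun _ _ => norm_nonneg _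
  refine le_of_forall_pos_le_add fun η hη => ?_
  -- Chosen so that the total error ε(P + Q) is at most η; the 1 avoids division by zero.
  set ε : ℝ := η / (P + Q + 1) with hε'
  have hε : 0 < ε := by positivity
  -- On `[0, T]` the minimum is ‖b(ψ)‖ itself; the truncation at B gives bounds on w valid for all
  -- real s.
  set w : ℝ → ℝ := fun s => (‖deriv ψ s‖ + ε) / (min ‖b (ψ s)‖ B + ε) with hw
  have hden (s : ℝ) : 0 < min ‖b (ψ s)‖ B + ε := by positivity
  have hwi : IntervalIntegrable w volume 0 T := by
    refine IntervalIntegrable.mul_continuousOn (hder.norm.add (by simp)) ?_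
    exact ContinuousOn.inv₀ ((hcont.norm.inf continuousOn_const).add continuousOn_const)
      fun s _ => (hden s).ne'
  have hwδ (s : ℝ) : ε / (B + ε) ≤ w s := by
    have := min_le_right ‖b (ψ s)‖ B
    exact div_le_div₀ (by positivity) (by linarith [norm_nonneg (deriv ψ s)]) (hden s)
      (by linarith)
  have hC (s : ℝ) : ‖deriv ψ s‖ ≤ (⟨B + ε, by positivity⟩ : ℝ≥0) * w s := by
    have := min_le_right ‖b (ψ s)‖ B
    show ‖deriv ψ s‖ ≤ (B + ε) * ((‖deriv ψ s‖ + ε) / (min ‖b (ψ s)‖ B + ε))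
    rw [mul_div_assoc', le_div_iff₀ (hden s)]
    nlinarith [norm_nonneg (deriv ψ s), mul_nonneg hB0 hε.le]
  obtain ⟨e, he0, heT, hlip, hF⟩ := exists_timeChange hT hac hwi (by positivity) hwδ hC
  have heT0 : 0 < e T := by rw [← he0]; exact e.strictMono hT
  have hadm : (ψ ∘ e.symm) ∈ admissible x₁ x₂ (e T) := by
    have h := mem_admissible_of_lipschitzOnWith heT0.le hlip
    have e0 : e.symm 0 = 0 := by rw [← he0, e.symm_apply_apply, he0]
    simpa only [Function.comp_apply, e0, e.symm_apply_apply, h0, h1] using h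
  refine (quasiPotential_le_action b heT0 hadm).trans ?_
  have hact : action b (e T) (ψ ∘ e.symm) =
      1 / 2 * ∫ s in (0 : ℝ)..T, w s * ‖(w s)⁻¹ • deriv ψ s - b (ψ s)‖ ^ 2 := by
    rw [action, ← hF fun y v => ‖v - b y‖ ^ 2]
    rfl
  have hgi := intervalIntegrable_geomAction hb hac
  have hle : ∫ s in (0 : ℝ)..T, w s * ‖(w s)⁻¹ • deriv ψ s - b (ψ s)‖ ^ 2 ≤
      ∫ s in (0 : ℝ)..T, (2 * (‖deriv ψ s‖ * ‖b (ψ s)‖ - inner ℝ (deriv ψ s) (b (ψ s)))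
        + ε * ‖deriv ψ s‖ + ε * ‖b (ψ s)‖) := by
    rw [intervalIntegral.integral_of_le hT.le, intervalIntegral.integral_of_le hT.le]
    -- Only the upper bound has to be shown integrable.
    refine integral_mono_of_nonneg (Eventually.of_forall fun s => ?_) ?_ ?_
    · exact mul_nonneg ((by positivity : 0 ≤ ε / (B + ε)).trans (hwδ s)) (by positivity)
    · exact ((hgi.const_mul 2).add (hder.norm.const_mul ε) |>.add
        (hcont.norm.intervalIntegrable.const_mul ε)).1
    · refine (ae_restrict_iff' measurableSet_Ioc).2 (Eventually.of_forall fun s hs => ?_)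
      have hws : w s = (‖deriv ψ s‖ + ε) / (‖b (ψ s)‖ + ε) := by
        rw [hw]; simp only [min_eq_left (hB s (Ioc_subset_Icc_self hs))]
      simp only [hws]
      exact timeChange_integrand_le _ _ hε hε
  rw [intervalIntegral.integral_add ((hgi.const_mul 2).add (hder.norm.const_mul ε))
      (hcont.norm.intervalIntegrable.const_mul ε),
    intervalIntegral.integral_add (hgi.const_mul 2) (hder.norm.const_mul ε),
    intervalIntegral.integral_const_mul, intervalIntegral.integral_const_mul,
    intervalIntegral.integral_const_mul, ← hP, ← hQ] at hle
  have hεη : ε * P + ε * Q ≤ η := by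
    rw [hε', ← mul_add, div_mul_eq_mul_div, div_le_iff₀ (by positivity)]
    nlinarith
  rw [hact, geomAction]
  linarith

/-! ### The optimal linear time scale -/

theorem memLp_two_iff_intervalIntegrable {f : ℝ → 𝔼 d} (hf : Measurable f) {T : ℝ} (hT : 0 ≤ T) :
    MemLp f 2 (volume.restrict (Icc 0 T)) ↔
      IntervalIntegrable (fun t => ‖f t‖ ^ 2) volume 0 T := by
  rw [memLp_two_iff_integrable_sq_norm hf.aestronglyMeasurable,
    intervalIntegrable_iff_integrableOn_Icc_of_le hT]
  rfl

theorem intervalIntegrable_norm_deriv_sq {x₁ x₂ : 𝔼 d} {T : ℝ} (hT : 0 ≤ T) {φ : ℝ → 𝔼 d}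
    (hφ : φ ∈ admissible x₁ x₂ T) : IntervalIntegrable (fun t => ‖deriv φ t‖ ^ 2) volume 0 T :=
  (memLp_two_iff_intervalIntegrable (measurable_deriv φ) hT).1 hφ.2

theorem admissible_comp_mul_left {x₁ x₂ : 𝔼 d} {c T S : ℝ} (hc : 0 < c) (hS : 0 ≤ S)
    (hT : c * S = T) {φ : ℝ → 𝔼 d} (hφ : φ ∈ admissible x₁ x₂ T) :
    (fun s => φ (c * s)) ∈ admissible x₁ x₂ S := by
  have hT0 : 0 ≤ T := hT ▸ mul_nonneg hc.le hS
  refine ⟨⟨hφ.1.1.comp_mul_left hc hT, by simp [hφ.1.2.1], by simp [hT, hφ.1.2.2]⟩, ?_⟩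
  rw [memLp_two_iff_intervalIntegrable (measurable_deriv _) hS]
  have h := ((intervalIntegrable_norm_deriv_sq hT0 hφ).comp_mul_left (c := c)).const_mul (c ^ 2)
  rw [← hT, zero_div, mul_div_cancel_left₀ _ hc.ne'] at h
  refine h.congr fun s _ => ?_
  show _ = ‖deriv (fun s => φ (c * s)) s‖ ^ 2
  rw [deriv_comp_mul_left, norm_smul, mul_pow, Real.norm_of_nonneg hc.le]

theorem action_comp_div (b : (𝔼 d) → 𝔼 d) {T : ℝ} (hT : 0 < T) (φ : ℝ → 𝔼 d) :
    action b T (fun t => φ (t / T)) = scaledAction b T φ := by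
  have h (t : ℝ) : deriv (fun t => φ (t / T)) t = T⁻¹ • deriv φ (t / T) := by
    simp_rw [div_eq_inv_mul]
    exact deriv_comp_mul_left _ _ _
  simp only [action, scaledAction, h]
  rw [intervalIntegral.integral_comp_div (fun s => ‖T⁻¹ • deriv φ s - b (φ s)‖ ^ 2) hT.ne',
    zero_div, div_self hT.ne', smul_eq_mul]
  ring

theorem curveLength_comp_div {T : ℝ} (hT : 0 < T) (φ : ℝ → 𝔼 d) :
    curveLength T (fun t => φ (t / T)) = ∫ s in (0 : ℝ)..1, ‖deriv φ s‖ := by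
  have h (t : ℝ) : ‖deriv (fun t => φ (t / T)) t‖ = T⁻¹ * ‖deriv φ (t / T)‖ := by
    simp_rw [div_eq_inv_mul]
    rw [deriv_comp_mul_left, norm_smul, Real.norm_of_nonneg (inv_nonneg.2 hT.le)]
  simp only [curveLength, h]
  rw [intervalIntegral.integral_const_mul,
    intervalIntegral.integral_comp_div (fun s => ‖deriv φ s‖) hT.ne',
    zero_div, div_self hT.ne', smul_eq_mul, inv_mul_cancel_left₀ hT.ne']

theorem intervalIntegral_mul_le_sqrt_mul_sqrt {f g : ℝ → ℝ} {a c : ℝ} (hac : a ≤ c)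
    (hf0 : ∀ s, 0 ≤ f s) (hg0 : ∀ s, 0 ≤ g s)
    (hfm : AEStronglyMeasurable f (volume.restrict (Ioc a c)))
    (hgm : AEStronglyMeasurable g (volume.restrict (Ioc a c)))
    (hf : IntervalIntegrable (fun s => f s ^ 2) volume a c)
    (hg : IntervalIntegrable (fun s => g s ^ 2) volume a c) :
    ∫ s in a..c, f s * g s ≤ √(∫ s in a..c, f s ^ 2) * √(∫ s in a..c, g s ^ 2) := by
  have h := integral_mul_le_Lp_mul_Lq_of_nonneg (μ := volume.restrict (Ioc a c))
    Real.HolderConjugate.two_two (Eventually.of_forall hf0) (Eventually.of_forall hg0)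
    (by simpa using (memLp_two_iff_integrable_sq hfm).2 hf.1)
    (by simpa using (memLp_two_iff_integrable_sq hgm).2 hg.1)
  simpa only [intervalIntegral.integral_of_le hac, Real.sqrt_eq_rpow, Real.rpow_two] using h

section

variable {b : (𝔼 d) → 𝔼 d} (hb : Continuous b) {x₁ x₂ : 𝔼 d} (hx : x₁ ≠ x₂) (hbx : b x₂ ≠ 0)
  {φ : ℝ → 𝔼 d} (hφ : φ ∈ admissible x₁ x₂ 1)

include hb hφ in
-- Expanding the square leaves a cross term free of T, so the optimization in T concerns only A/T +
-- TB.
theorem scaledAction_eq {T : ℝ} (hT : 0 < T) :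
    scaledAction b T φ = ((∫ s in (0 : ℝ)..1, ‖deriv φ s‖ ^ 2) / T
      + T * ∫ s in (0 : ℝ)..1, ‖b (φ s)‖ ^ 2) / 2
      - ∫ s in (0 : ℝ)..1, inner ℝ (deriv φ s) (b (φ s)) := by
  have hA := intervalIntegrable_norm_deriv_sq zero_le_one hφ
  have hc := continuousOn_comp_of_ac hb hφ.1.1
  have hB : IntervalIntegrable (fun s => ‖b (φ s)‖ ^ 2) volume 0 1 :=
    (hc.norm.pow 2).intervalIntegrable
  have hC : IntervalIntegrable (fun s => inner ℝ (deriv φ s) (b (φ s))) volume 0 1 := by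
    have h := ((intervalIntegrable_deriv hφ.1.1).norm.mul_continuousOn hc.norm).sub
      (intervalIntegrable_geomAction hb hφ.1.1)
    simpa using h
  have h (s : ℝ) : ‖T⁻¹ • deriv φ s - b (φ s)‖ ^ 2 =
      T⁻¹ ^ 2 * ‖deriv φ s‖ ^ 2 - 2 * T⁻¹ * inner ℝ (deriv φ s) (b (φ s)) + ‖b (φ s)‖ ^ 2 := by
    rw [@norm_sub_sq_real, norm_smul, real_inner_smul_left,
      Real.norm_of_nonneg (inv_nonneg.2 hT.le)]
    ring
  simp only [scaledAction, h]
  rw [intervalIntegral.integral_add ((hA.const_mul _).sub (hC.const_mul _)) hB,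
    intervalIntegral.integral_sub (hA.const_mul _) (hC.const_mul _),
    intervalIntegral.integral_const_mul, intervalIntegral.integral_const_mul]
  field_simp
  ring

include hφ hb in
theorem integral_norm_deriv_mul_norm_drift_le :
    ∫ s in (0 : ℝ)..1, ‖deriv φ s‖ * ‖b (φ s)‖ ≤
      √(∫ s in (0 : ℝ)..1, ‖deriv φ s‖ ^ 2) * √(∫ s in (0 : ℝ)..1, ‖b (φ s)‖ ^ 2) := by
  have hc := (continuousOn_comp_of_ac hb hφ.1.1).norm
  refine intervalIntegral_mul_le_sqrt_mul_sqrt zero_le_one (fun _ => norm_nonneg _)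
    (fun _ => norm_nonneg _) (measurable_deriv φ).norm.aestronglyMeasurable ?_
    (intervalIntegrable_norm_deriv_sq zero_le_one hφ) (hc.pow 2).intervalIntegrable
  exact (hc.mono (by rw [uIcc_of_le zero_le_one]; exact Ioc_subset_Icc_self)).aestronglyMeasurable
    measurableSet_Ioc

include hx hφ in
-- The distance of the endpoints is at most the length, which is at most the L² norm of φ' on the
-- unit interval.
theorem integral_norm_deriv_sq_pos : 0 < ∫ s in (0 : ℝ)..1, ‖deriv φ s‖ ^ 2 := by
  have h1 := norm_sub_le_integral_norm_deriv zero_le_one hφ.1.1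
  rw [hφ.1.2.1, hφ.1.2.2] at h1
  have h2 := intervalIntegral_mul_le_sqrt_mul_sqrt (f := fun s => ‖deriv φ s‖) (g := fun _ => 1)
    (zero_le_one' ℝ) (fun _ => norm_nonneg _) (fun _ => zero_le_one)
    (measurable_deriv φ).norm.aestronglyMeasurable aestronglyMeasurable_const
    (intervalIntegrable_norm_deriv_sq zero_le_one hφ) (by simp)
  have h3 : 0 < ‖x₂ - x₁‖ := norm_pos_iff.2 (sub_ne_zero.2 hx.symm)
  simp only [mul_one, one_pow, intervalIntegral.integral_const, sub_zero, smul_eq_mul,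
    Real.sqrt_one] at h2
  exact Real.sqrt_pos.1 (h3.trans_le (h1.trans h2))

include hb hbx hφ in
theorem integral_norm_drift_sq_pos : 0 < ∫ s in (0 : ℝ)..1, ‖b (φ s)‖ ^ 2 := by
  have hc := (continuousOn_comp_of_ac hb hφ.1.1).norm.pow 2
  rw [uIcc_of_le zero_le_one] at hc
  refine intervalIntegral.integral_pos zero_lt_one hc (fun _ _ => by positivity) ⟨1, by simp, ?_⟩
  rw [hφ.1.2.2]
  have := norm_pos_iff.2 hbx
  positivity

include hb hx hbx hφ

theorem optTime_pos : 0 < optTime b φ :=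
  div_pos (Real.sqrt_pos.2 (integral_norm_deriv_sq_pos hx hφ))
    (Real.sqrt_pos.2 (integral_norm_drift_sq_pos hb hbx hφ))

theorem optAction_eq :
    optAction b φ = √(∫ s in (0 : ℝ)..1, ‖deriv φ s‖ ^ 2) * √(∫ s in (0 : ℝ)..1, ‖b (φ s)‖ ^ 2)
      - ∫ s in (0 : ℝ)..1, inner ℝ (deriv φ s) (b (φ s)) := by
  rw [optAction, scaledAction_eq hb hφ (optTime_pos hb hx hbx hφ), optTime]
  have hA := integral_norm_deriv_sq_pos hx hφ
  have hB := integral_norm_drift_sq_pos hb hbx hφ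
  set A := ∫ s in (0 : ℝ)..1, ‖deriv φ s‖ ^ 2
  set B := ∫ s in (0 : ℝ)..1, ‖b (φ s)‖ ^ 2
  have hA' := Real.sqrt_pos.2 hA
  have hB' := Real.sqrt_pos.2 hB
  have hAs : A = √A ^ 2 := (Real.sq_sqrt hA.le).symm
  have hBs : B = √B ^ 2 := (Real.sq_sqrt hB.le).symm
  have h1 : A / (√A / √B) = √A * √B := by
    rw [div_div_eq_mul_div, div_eq_iff hA'.ne']
    nlinarith
  have h2 : √A / √B * B = √A * √B := by
    rw [div_mul_eq_mul_div, div_eq_iff hB'.ne']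
    nlinarith
  rw [h1, h2]
  ring

/-- AM-GM: the difference of the two sides is (√A - T√B)²/(2T). -/
theorem optAction_le_scaledAction {T : ℝ} (hT : 0 < T) : optAction b φ ≤ scaledAction b T φ := by
  rw [optAction_eq hb hx hbx hφ, scaledAction_eq hb hφ hT]
  have hA := integral_norm_deriv_sq_pos hx hφ
  have hB := integral_norm_drift_sq_pos hb hbx hφ
  set A := ∫ s in (0 : ℝ)..1, ‖deriv φ s‖ ^ 2
  set B := ∫ s in (0 : ℝ)..1, ‖b (φ s)‖ ^ 2
  have hAs : √A ^ 2 = A := Real.sq_sqrt hA.le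
  have hBs : √B ^ 2 = B := Real.sq_sqrt hB.le
  have h : √A * √B ≤ (A / T + T * B) / 2 := by
    have h1 : A / T + T * B - 2 * (√A * √B) = (√A - T * √B) ^ 2 / T := by
      rw [sub_sq, mul_pow, hAs, hBs]
      field_simp
      ring
    have h2 : 0 ≤ (√A - T * √B) ^ 2 / T := by positivity
    linarith
  linarith

theorem geomAction_le_optAction : geomAction b 1 φ ≤ optAction b φ := by
  rw [optAction_eq hb hx hbx hφ, geomAction]
  have h1 := (intervalIntegrable_deriv hφ.1.1).norm.mul_continuousOn
    (continuousOn_comp_of_ac hb hφ.1.1).norm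
  have h2 : IntervalIntegrable (fun s => inner ℝ (deriv φ s) (b (φ s))) volume 0 1 := by
    simpa using h1.sub (intervalIntegrable_geomAction hb hφ.1.1)
  rw [intervalIntegral.integral_sub h1 h2]
  linarith [integral_norm_deriv_mul_norm_drift_le hb hφ]

theorem action_timePath : action b (optTime b φ) (timePath b φ) = optAction b φ :=
  action_comp_div b (optTime_pos hb hx hbx hφ) φ

theorem curveLength_timePath :
    curveLength (optTime b φ) (timePath b φ) = ∫ s in (0 : ℝ)..1, ‖deriv φ s‖ :=
  curveLength_comp_div (optTime_pos hb hx hbx hφ) φ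

theorem quasiPotential_le_optAction : quasiPotential b x₁ x₂ ≤ optAction b φ := by
  have hT := optTime_pos hb hx hbx hφ
  rw [← action_timePath hb hx hbx hφ]
  refine quasiPotential_le_action b hT ?_
  have := admissible_comp_mul_left (inv_pos.2 hT) hT.le (inv_mul_cancel₀ hT.ne') hφ
  have htp : timePath b φ = fun s => φ ((optTime b φ)⁻¹ * s) := by
    ext1 s
    rw [timePath, div_eq_inv_mul]
  rwa [htp]

/-- Ŝ(φ) is the action of a path in physical time, and conversely any action on `[0, T]` is a
rescaled action on `[0, 1]`, which dominates Ŝ. The given φ provides nonemptiness. -/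
theorem sInf_optAction_eq_quasiPotential :
    sInf (optAction b '' admissible x₁ x₂ 1) = quasiPotential b x₁ x₂ := by
  have hbdd : BddBelow (optAction b '' admissible x₁ x₂ 1) := by
    refine ⟨quasiPotential b x₁ x₂, ?_⟩
    rintro _ ⟨ψ, hψ, rfl⟩
    exact quasiPotential_le_optAction hb hx hbx hψ
  refine le_antisymm ?_ ?_
  · refine le_csInf ⟨_, 1, zero_lt_one, φ, hφ, rfl⟩ ?_
    rintro _ ⟨T, hT, ψ, hψ, rfl⟩
    have hψ' := admissible_comp_mul_left hT zero_le_one (mul_one T) hψ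
    refine (csInf_le hbdd ⟨_, hψ', rfl⟩).trans ?_
    refine (optAction_le_scaledAction hb hx hbx hψ' hT).trans_eq ?_
    rw [← action_comp_div b hT]
    simp only [mul_div_cancel₀ _ hT.ne']
  · refine le_csInf ⟨_, φ, hφ, rfl⟩ ?_
    rintro _ ⟨ψ, hψ, rfl⟩
    exact quasiPotential_le_optAction hb hx hbx hψ

end

/-- Minimizers under the constraints `T̂ ≤ n` form a minimizing sequence. -/
theorem tendsto_optAction_constrainedMinimizer {b : (𝔼 d) → 𝔼 d} (hb : Continuous b)
    {x₁ x₂ : 𝔼 d} (hx : x₁ ≠ x₂) (hbx : b x₂ ≠ 0) {N : ℕ} {φ : ℕ → ℝ → 𝔼 d}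
    (hφ : ∀ n, N ≤ n → IsConstrainedMinimizer b x₁ x₂ n (φ n)) :
    Tendsto (fun n => optAction b (φ n)) atTop (𝓝 (quasiPotential b x₁ x₂)) := by
  have hN := (hφ N le_rfl).1
  have hV := sInf_optAction_eq_quasiPotential hb hx hbx hN
  refine tendsto_order.2 ⟨fun c hc => ?_, fun c hc => ?_⟩
  · filter_upwards [eventually_ge_atTop N] with n hn
    exact hc.trans_le (quasiPotential_le_optAction hb hx hbx (hφ n hn).1)
  · rw [← hV] at hc
    obtain ⟨_, ⟨ψ, hψ, rfl⟩, hlt⟩ := exists_lt_of_csInf_lt (Set.Nonempty.image _ ⟨φ N, hN⟩) hc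
    -- A nearly optimal ψ satisfies the constraint for all n ≥ M.
    obtain ⟨M, hM⟩ := exists_nat_ge (optTime b ψ)
    filter_upwards [eventually_ge_atTop (max N M)] with n hn
    refine ((hφ n (le_trans (le_max_left _ _) hn)).2.2 ψ hψ (hM.trans ?_)).trans_lt hlt
    exact_mod_cast le_trans (le_max_right _ _) hn

/-! ### Lower semicontinuity of the geometric action -/

/-- The geometric Lagrangian `|v| |y| - ⟨v, y⟩`. -/
noncomputable def geomLagrangian (v y : 𝔼 d) : ℝ := ‖v‖ * ‖y‖ - inner ℝ v y

theorem geomLagrangian_nonneg (v y : 𝔼 d) : 0 ≤ geomLagrangian v y :=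
  sub_nonneg.2 (real_inner_le_norm v y)

theorem geomLagrangian_le (v y : 𝔼 d) : geomLagrangian v y ≤ 2 * (‖v‖ * ‖y‖) := by
  have := neg_le_of_abs_le (abs_real_inner_le_norm v y)
  unfold geomLagrangian
  linarith

theorem geomLagrangian_smul {c : ℝ} (hc : 0 ≤ c) (v y : 𝔼 d) :
    geomLagrangian (c • v) y = c * geomLagrangian v y := by
  rw [geomLagrangian, geomLagrangian, norm_smul, real_inner_smul_left, Real.norm_of_nonneg hc]
  ring

theorem _root_.Filter.Tendsto.geomLagrangian {α : Type*} {l : Filter α} {f g : α → 𝔼 d}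
    {v y : 𝔼 d}
    (hf : Tendsto f l (𝓝 v)) (hg : Tendsto g l (𝓝 y)) :
    Tendsto (fun a => geomLagrangian (f a) (g a)) l (𝓝 (geomLagrangian v y)) :=
  (hf.norm.mul hg.norm).sub (hf.inner hg)

theorem _root_.Continuous.geomLagrangian {f g : ℝ → 𝔼 d} (hf : Continuous f)
    (hg : Continuous g) : Continuous fun a => geomLagrangian (f a) (g a) :=
  (hf.norm.mul hg.norm).sub (hf.inner hg)

theorem geomLagrangian_le_add (v y z : 𝔼 d) :
    geomLagrangian v z ≤ geomLagrangian v y + 2 * (‖v‖ * ‖z - y‖) := by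
  have h1 : ‖z‖ ≤ ‖y‖ + ‖z - y‖ := by
    simpa using norm_add_le y (z - y)
  have h2 := neg_le_of_abs_le (abs_real_inner_le_norm v (z - y))
  rw [inner_sub_right] at h2
  have h3 := mul_le_mul_of_nonneg_left h1 (norm_nonneg v)
  unfold geomLagrangian
  linarith

theorem geomAction_congr (b : (𝔼 d) → 𝔼 d) {T : ℝ} (hT : 0 ≤ T) {f g : ℝ → 𝔼 d}
    (h : EqOn f g (Icc 0 T)) : geomAction b T f = geomAction b T g := by
  rw [geomAction, geomAction, intervalIntegral.integral_of_le hT,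
    intervalIntegral.integral_of_le hT, ← setIntegral_congr_set Ioo_ae_eq_Ioc,
    ← setIntegral_congr_set Ioo_ae_eq_Ioc]
  refine setIntegral_congr_fun measurableSet_Ioo fun s hs => ?_
  have h1 : f =ᶠ[𝓝 s] g := h.eventuallyEq_of_mem (Icc_mem_nhds hs.1 hs.2)
  simp only [h1.deriv_eq, h1.eq_of_nhds]

theorem ac_of_lipschitzWith {C : ℝ≥0} {γ : ℝ → 𝔼 d} (hγ : LipschitzWith C γ) (s t : ℝ) :
    AbsolutelyContinuousOnInterval γ s t :=
  (hγ.lipschitzOnWith (s := uIcc s t)).absolutelyContinuousOnInterval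

theorem intervalIntegrable_geomLagrangian {C : ℝ≥0} {γ : ℝ → 𝔼 d}
    (hγ : LipschitzWith C γ) {y : ℝ → 𝔼 d} (hy : Continuous y) (s t : ℝ) :
    IntervalIntegrable (fun r => geomLagrangian (deriv γ r) (y r)) volume s t := by
  have h1 := (intervalIntegrable_deriv (ac_of_lipschitzWith hγ s t)).norm.mul_continuousOn
    hy.norm.continuousOn
  refine (h1.const_mul 2).mono_fun ?_ (Eventually.of_forall fun r => ?_)
  · exact (((measurable_deriv γ).norm.mul hy.measurable.norm).sub
      ((measurable_deriv γ).inner hy.measurable)).aestronglyMeasurable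
  · beta_reduce
    rw [Real.norm_of_nonneg (geomLagrangian_nonneg _ _)]
    exact (geomLagrangian_le _ _).trans (le_abs_self _)

/-- With the drift frozen at γ(s) this is convexity in the velocity: the norm of an increment is at
most the length, and the inner product is linear. Unfreezing costs at most 2·C·(K·C·h) pointwise,
over an interval of length h. -/
theorem geomLagrangian_increment_le {b : (𝔼 d) → 𝔼 d} {K C : ℝ≥0} (hb : LipschitzWith K b)
    {γ : ℝ → 𝔼 d} (hγ : LipschitzWith C γ) {s h : ℝ} (hh : 0 ≤ h) :
    geomLagrangian (γ (s + h) - γ s) (b (γ s)) ≤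
      (∫ r in s..s + h, geomLagrangian (deriv γ r) (b (γ r))) + 2 * K * C ^ 2 * h * h := by
  have hsh : s ≤ s + h := by linarith
  have hac := ac_of_lipschitzWith hγ s (s + h)
  have hder := intervalIntegrable_deriv hac
  have hin : ∫ r in s..s + h, inner ℝ (deriv γ r) (b (γ s)) =
      inner ℝ (γ (s + h) - γ s) (b (γ s)) := by
    have := (innerSL ℝ (b (γ s))).intervalIntegral_comp_comm hder
    rw [integral_deriv_eq_sub hac] at this
    simpa only [innerSL_apply_apply, real_inner_comm] using this
  have hini : IntervalIntegrable (fun r => inner ℝ (deriv γ r) (b (γ s))) volume s (s + h) := by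
    have : IntervalIntegrable (fun r => innerSL ℝ (b (γ s)) (deriv γ r)) volume s (s + h) :=
      And.intro ((innerSL ℝ (b (γ s))).integrable_comp hder.1)
        ((innerSL ℝ (b (γ s))).integrable_comp hder.2)
    simpa only [innerSL_apply_apply, real_inner_comm] using this
  have h1 : geomLagrangian (γ (s + h) - γ s) (b (γ s)) ≤
      ∫ r in s..s + h, geomLagrangian (deriv γ r) (b (γ s)) := by
    simp only [geomLagrangian]
    rw [intervalIntegral.integral_sub (hder.norm.mul_const _) hini, hin,
      intervalIntegral.integral_mul_const]
    have := mul_le_mul_of_nonneg_right (norm_sub_le_integral_norm_deriv hsh hac)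
      (norm_nonneg (b (γ s)))
    linarith
  have hbγ : Continuous fun r => b (γ r) := hb.continuous.comp hγ.continuous
  have hi := intervalIntegrable_geomLagrangian hγ hbγ s (s + h)
  refine h1.trans ?_
  have h2 : ∫ r in s..s + h, geomLagrangian (deriv γ r) (b (γ s)) ≤
      ∫ r in s..s + h, (geomLagrangian (deriv γ r) (b (γ r)) + 2 * K * C ^ 2 * h) := by
    refine intervalIntegral.integral_mono_on hsh
      (intervalIntegrable_geomLagrangian hγ continuous_const _ _)
      (hi.add intervalIntegrable_const) fun r hr => ?_
    refine (geomLagrangian_le_add _ (b (γ r)) _).trans (add_le_add le_rfl ?_)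
    have h3 : ‖deriv γ r‖ ≤ C := norm_deriv_le_of_lipschitz hγ
    have h4 : ‖b (γ s) - b (γ r)‖ ≤ K * (C * h) := by
      rw [← dist_eq_norm]
      refine (hb.dist_le_mul _ _).trans (mul_le_mul_of_nonneg_left ?_ K.2)
      refine (hγ.dist_le_mul _ _).trans (mul_le_mul_of_nonneg_left ?_ C.2)
      rw [Real.dist_eq, abs_le]
      constructor <;> linarith [hr.1, hr.2]
    have h5 := mul_le_mul h3 h4 (norm_nonneg _) C.2
    calc 2 * (‖deriv γ r‖ * ‖b (γ s) - b (γ r)‖) ≤ 2 * (C * (K * (C * h))) := by linarith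
      _ = 2 * K * C ^ 2 * h := by ring
  rw [intervalIntegral.integral_add hi intervalIntegrable_const,
    intervalIntegral.integral_const, smul_eq_mul] at h2
  refine h2.trans_eq ?_
  ring

/-- The geometric action with the derivative replaced by a difference quotient. -/
noncomputable def discreteGeomAction (b : (𝔼 d) → 𝔼 d) (h : ℝ) (γ : ℝ → 𝔼 d) : ℝ :=
  ∫ s in (0 : ℝ)..1, geomLagrangian (h⁻¹ • (γ (s + h) - γ s)) (b (γ s))

theorem continuous_discrete_integrand {b : (𝔼 d) → 𝔼 d} (hb : Continuous b)
    {γ : ℝ → 𝔼 d} (hγ : Continuous γ) (h : ℝ) :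
    Continuous fun s => geomLagrangian (h⁻¹ • (γ (s + h) - γ s)) (b (γ s)) := by
  have h1 : Continuous fun s => γ (s + h) := hγ.comp (continuous_add_const h)
  have h2 : Continuous fun s => h⁻¹ • (γ (s + h) - γ s) := (h1.fun_sub hγ).fun_const_smul _
  exact h2.geomLagrangian (hb.comp hγ)

/-- Averages the increment estimate over s. For the primitive F of the Lagrangian, the mean of (F(s
+ h) - F(s))/h over `[0, 1]` is at most F(1), as F ≥ 0 on [0, ∞) and F is constant after 1. -/
theorem discreteGeomAction_le {b : (𝔼 d) → 𝔼 d} {K C : ℝ≥0} (hb : LipschitzWith K b)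
    {γ : ℝ → 𝔼 d} (hγ : LipschitzWith C γ) (hend : ∀ s, 1 ≤ s → γ s = γ 1) {h : ℝ} (hh : 0 < h) :
    discreteGeomAction b h γ ≤ geomAction b 1 γ + 2 * K * C ^ 2 * h := by
  have hbγ : Continuous fun r => b (γ r) := hb.continuous.comp hγ.continuous
  have hi := intervalIntegrable_geomLagrangian hγ hbγ
  set F : ℝ → ℝ := fun s => ∫ r in (0 : ℝ)..s, geomLagrangian (deriv γ r) (b (γ r)) with hF
  have hFc : Continuous F := intervalIntegral.continuous_primitive hi 0
  have hF0 : ∀ s, 0 ≤ s → 0 ≤ F s := fun s hs =>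
    intervalIntegral.integral_nonneg hs fun _ _ => geomLagrangian_nonneg _ _
  have hF1 : ∀ s, 1 ≤ s → F s = F 1 := fun s hs => by
    rw [← sub_eq_zero, hF, intervalIntegral.integral_interval_sub_left (hi _ _) (hi _ _)]
    refine intervalIntegral.integral_zero_ae (Eventually.of_forall fun r hr => ?_)
    rw [uIoc_of_le hs] at hr
    have : γ =ᶠ[𝓝 r] fun _ => γ 1 := by
      filter_upwards [lt_mem_nhds hr.1] with q hq using hend q hq.le
    rw [this.deriv_eq, deriv_const]
    simp [geomLagrangian]
  have hsmul (s : ℝ) : geomLagrangian (h⁻¹ • (γ (s + h) - γ s)) (b (γ s)) ≤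
      h⁻¹ * (F (s + h) - F s) + 2 * K * C ^ 2 * h := by
    rw [geomLagrangian_smul (inv_nonneg.2 hh.le), hF,
      intervalIntegral.integral_interval_sub_left (hi _ _) (hi _ _)]
    refine (mul_le_mul_of_nonneg_left (geomLagrangian_increment_le hb hγ hh.le)
      (inv_nonneg.2 hh.le)).trans_eq ?_
    field_simp
  have hcont := continuous_discrete_integrand hb.continuous hγ.continuous h
  have hFs : Continuous fun s => F (s + h) := hFc.comp (continuous_add_const h)
  -- The left side equals the integral of F over [1, 1 + h] minus that over [0, h].
  have hint : ∫ s in (0 : ℝ)..1, (F (s + h) - F s) ≤ h * F 1 := by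
    rw [intervalIntegral.integral_sub (hFs.intervalIntegrable _ _) (hFc.intervalIntegrable _ _),
      intervalIntegral.integral_comp_add_right (fun s => F s), zero_add]
    have e1 := intervalIntegral.integral_add_adjacent_intervals
      (hFc.intervalIntegrable (μ := volume) 0 h) (hFc.intervalIntegrable h (1 + h))
    have e2 := intervalIntegral.integral_add_adjacent_intervals
      (hFc.intervalIntegrable (μ := volume) 0 1) (hFc.intervalIntegrable 1 (1 + h))
    have e3 : ∫ s in (1 : ℝ)..1 + h, F s = h * F 1 := by
      have : ∫ s in (1 : ℝ)..1 + h, F s = ∫ s in (1 : ℝ)..1 + h, F 1 := by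
        refine intervalIntegral.integral_congr fun s hs => hF1 s ?_
        rw [uIcc_of_le (by linarith)] at hs
        exact hs.1
      rw [this, intervalIntegral.integral_const, smul_eq_mul]
      ring
    have e4 : 0 ≤ ∫ s in (0 : ℝ)..h, F s :=
      intervalIntegral.integral_nonneg hh.le fun s hs => hF0 s hs.1
    linarith
  have hmain : discreteGeomAction b h γ ≤
      ∫ s in (0 : ℝ)..1, (h⁻¹ * (F (s + h) - F s) + 2 * K * C ^ 2 * h) :=
    intervalIntegral.integral_mono_on zero_le_one (hcont.intervalIntegrable _ _)
      ((((hFs.fun_sub hFc).const_mul _).fun_add continuous_const).intervalIntegrable _ _)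
      fun s _ => hsmul s
  rw [intervalIntegral.integral_add (((hFs.fun_sub hFc).const_mul _).intervalIntegrable _ _)
      intervalIntegrable_const, intervalIntegral.integral_const_mul,
    intervalIntegral.integral_const, sub_zero, one_smul] at hmain
  have hfin := mul_le_mul_of_nonneg_left hint (inv_nonneg.2 hh.le)
  rw [inv_mul_cancel_left₀ hh.ne'] at hfin
  have hgeom : geomAction b 1 γ = F 1 := rfl
  rw [hgeom]
  linarith

theorem norm_difference_quotient_le {C : ℝ≥0} {γ : ℝ → 𝔼 d} (hγ : LipschitzWith C γ) {h : ℝ}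
    (hh : 0 < h) (s : ℝ) : ‖h⁻¹ • (γ (s + h) - γ s)‖ ≤ C := by
  have h1 := hγ.dist_le_mul (s + h) s
  rw [dist_eq_norm, Real.dist_eq, add_sub_cancel_left, abs_of_pos hh] at h1
  rw [norm_smul, Real.norm_of_nonneg (inv_nonneg.2 hh.le), inv_mul_le_iff₀ hh, mul_comm]
  exact h1

theorem norm_drift_le {b : (𝔼 d) → 𝔼 d} {K C : ℝ≥0} (hb : LipschitzWith K b)
    {γ : ℝ → 𝔼 d} (hγ : LipschitzWith C γ) {s : ℝ} (hs : s ∈ Icc (0 : ℝ) 1) :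
    ‖b (γ s)‖ ≤ ‖b (γ 0)‖ + K * C := by
  have h1 := (hb.comp hγ).dist_le_mul s 0
  have h2 : ‖b (γ s)‖ ≤ ‖b (γ 0)‖ + ‖b (γ s) - b (γ 0)‖ := by
    simpa using norm_add_le (b (γ 0)) (b (γ s) - b (γ 0))
  rw [Real.dist_eq, sub_zero, abs_of_nonneg hs.1, dist_eq_norm] at h1
  have h3 : ((K * C : ℝ≥0) : ℝ) * s ≤ K * C := by
    push_cast
    exact mul_le_of_le_one_right (by positivity) hs.2
  simp only [Function.comp_apply] at h1
  linarith

theorem norm_discrete_integrand_le {b : (𝔼 d) → 𝔼 d} {K C : ℝ≥0} (hb : LipschitzWith K b)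
    {γ : ℝ → 𝔼 d} (hγ : LipschitzWith C γ) {h : ℝ} (hh : 0 < h) {s : ℝ}
    (hs : s ∈ uIoc (0 : ℝ) 1) :
    ‖geomLagrangian (h⁻¹ • (γ (s + h) - γ s)) (b (γ s))‖ ≤
      2 * (C * (‖b (γ 0)‖ + K * C)) := by
  rw [uIoc_of_le zero_le_one] at hs
  rw [Real.norm_of_nonneg (geomLagrangian_nonneg _ _)]
  refine (geomLagrangian_le _ _).trans (mul_le_mul_of_nonneg_left ?_ zero_le_two)
  exact mul_le_mul (norm_difference_quotient_le hγ hh s) (norm_drift_le hb hγ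
    (Ioc_subset_Icc_self hs)) (norm_nonneg _) C.2

/-- At fixed h no derivative occurs, so pointwise convergence and domination suffice. -/
theorem tendsto_discreteGeomAction_of_tendsto {b : (𝔼 d) → 𝔼 d} {K C : ℝ≥0}
    (hb : LipschitzWith K b) {γ : ℕ → ℝ → 𝔼 d} {g : ℝ → 𝔼 d} (hγ : ∀ n, LipschitzWith C (γ n))
    {p : 𝔼 d} (hp : ∀ n, γ n 0 = p) (hlim : ∀ s, Tendsto (fun n => γ n s) atTop (𝓝 (g s)))
    {h : ℝ} (hh : 0 < h) :
    Tendsto (fun n => discreteGeomAction b h (γ n)) atTop (𝓝 (discreteGeomAction b h g)) := by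
  refine intervalIntegral.tendsto_integral_filter_of_dominated_convergence
    (fun _ => 2 * (C * (‖b p‖ + K * C))) (Eventually.of_forall fun n => ?_)
    (Eventually.of_forall fun n => Eventually.of_forall fun s hs => ?_) (by simp)
    (Eventually.of_forall fun s _ => ?_)
  · exact (continuous_discrete_integrand hb.continuous (hγ n).continuous h).aestronglyMeasurable
  · rw [← hp n]
    exact norm_discrete_integrand_le hb (hγ n) hh hs
  · exact (((hlim (s + h)).sub (hlim s)).const_smul _).geomLagrangian
      ((hb.continuous.tendsto _).comp (hlim s))

/-- Lipschitz curves are differentiable almost everywhere, and their difference quotients are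
bounded by C. -/
theorem tendsto_discreteGeomAction_zero {b : (𝔼 d) → 𝔼 d} {K C : ℝ≥0}
    (hb : LipschitzWith K b) {g : ℝ → 𝔼 d} (hg : LipschitzWith C g) :
    Tendsto (fun h => discreteGeomAction b h g) (𝓝[>] 0) (𝓝 (geomAction b 1 g)) := by
  refine intervalIntegral.tendsto_integral_filter_of_dominated_convergence
    (fun _ => 2 * (C * (‖b (g 0)‖ + K * C))) (Eventually.of_forall fun h => ?_)
    (eventually_mem_nhdsWithin.mono fun h hh => Eventually.of_forall fun s hs => ?_) (by simp) ?_
  · exact (continuous_discrete_integrand hb.continuous hg.continuous h).aestronglyMeasurable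
  · exact norm_discrete_integrand_le hb hg hh hs
  · filter_upwards [hg.ae_differentiableAt_real] with s hs _
    exact hs.hasDerivAt.tendsto_slope_zero_right.geomLagrangian tendsto_const_nhds

/-- The geometric action is lower semicontinuous along equi-Lipschitz curves on `[0, 1]`. -/
theorem geomAction_le_of_tendsto {b : (𝔼 d) → 𝔼 d} {K C : ℝ≥0}
    (hb : LipschitzWith K b) {γ : ℕ → ℝ → 𝔼 d} {g : ℝ → 𝔼 d} (hγ : ∀ n, LipschitzWith C (γ n))
    (hg : LipschitzWith C g) (hend : ∀ n s, 1 ≤ s → γ n s = γ n 1)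
    {p : 𝔼 d} (hp : ∀ n, γ n 0 = p) (hlim : ∀ s, Tendsto (fun n => γ n s) atTop (𝓝 (g s)))
    {a : ℕ → ℝ} {V : ℝ} (ha : Tendsto a atTop (𝓝 V)) (hle : ∀ n, geomAction b 1 (γ n) ≤ a n) :
    geomAction b 1 g ≤ V := by
  -- First n → ∞ at fixed h; only afterwards h ↓ 0.
  have h1 : ∀ h : ℝ, 0 < h → discreteGeomAction b h g ≤ V + 2 * K * C ^ 2 * h := fun h hh =>
    le_of_tendsto_of_tendsto' (tendsto_discreteGeomAction_of_tendsto hb hγ hp hlim hh)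
      (ha.add_const _) fun n => (discreteGeomAction_le hb (hγ n) (hend n) hh).trans
        (add_le_add (hle n) le_rfl)
  have h2 : Tendsto (fun h : ℝ => V + 2 * K * C ^ 2 * h) (𝓝[>] 0) (𝓝 V) := by
    have : Continuous fun h : ℝ => V + 2 * (K : ℝ) * C ^ 2 * h := by fun_prop
    simpa using (this.tendsto 0).mono_left nhdsWithin_le_nhds
  exact le_of_tendsto_of_tendsto (tendsto_discreteGeomAction_zero hb hg) h2
    (eventually_mem_nhdsWithin.mono h1)

/-! ### Compactness of curves of bounded length -/

/-- An absolutely continuous curve of length at most `L` is a reparametrization of a Lipschitz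
curve with constant `L + 1`. -/
theorem exists_lipschitz_reparametrization (b : (𝔼 d) → 𝔼 d) {φ : ℝ → 𝔼 d}
    (hφ : AbsolutelyContinuousOnInterval φ 0 1) {L : ℝ≥0}
    (hL : ∫ s in (0 : ℝ)..1, ‖deriv φ s‖ ≤ L) :
    ∃ γ : ℝ → 𝔼 d, LipschitzWith (L + 1) γ ∧ γ 0 = φ 0 ∧ γ 1 = φ 1 ∧
      (∀ s, γ s = γ (projIcc 0 1 zero_le_one s)) ∧ geomAction b 1 γ = geomAction b 1 φ ∧
      ∃ β ∈ reparam 1, ∀ s ∈ Icc (0 : ℝ) 1, γ (β s) = φ s := by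
  have hder := intervalIntegrable_deriv hφ
  set ℓ := ∫ s in (0 : ℝ)..1, ‖deriv φ s‖ with hℓ
  have hℓ0 : 0 ≤ ℓ := intervalIntegral.integral_nonneg zero_le_one fun _ _ => norm_nonneg _
  -- Arc length plus time, normalized so that the new interval is again `[0, 1]`. The added 1 keeps
  -- the clock strictly increasing where φ rests.
  set w : ℝ → ℝ := fun s => (ℓ + 1)⁻¹ * (‖deriv φ s‖ + 1) with hw
  have hℓ1 : 0 < (ℓ + 1)⁻¹ := by positivity
  have hwi : IntervalIntegrable w volume 0 1 :=
    (hder.norm.add intervalIntegrable_const).const_mul _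
  have hwδ (s : ℝ) : (ℓ + 1)⁻¹ ≤ w s :=
    le_mul_of_one_le_right hℓ1.le (by linarith [norm_nonneg (deriv φ s)])
  have hC (s : ℝ) : ‖deriv φ s‖ ≤ ((L + 1 : ℝ≥0) : ℝ) * w s := by
    have h1 : (ℓ + 1) * w s = ‖deriv φ s‖ + 1 := by
      rw [hw]; field_simp
    have h2 : (ℓ + 1) * w s ≤ ((L + 1 : ℝ≥0) : ℝ) * w s := by
      refine mul_le_mul_of_nonneg_right ?_ (hℓ1.le.trans (hwδ s))
      push_cast
      linarith
    linarith
  obtain ⟨e, he0, he1, hlip, hF⟩ := exists_timeChange zero_lt_one hφ hwi hℓ1 hwδ hC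
  have he1 : e 1 = 1 := by
    rw [he1, hw, intervalIntegral.integral_const_mul,
      intervalIntegral.integral_add hder.norm intervalIntegrable_const, ← hℓ]
    simp only [intervalIntegral.integral_const, sub_zero, smul_eq_mul, mul_one]
    exact inv_mul_cancel₀ (by positivity)
  have hs0 : e.symm 0 = 0 := by rw [e.symm_apply_eq, he0]
  have hs1 : e.symm 1 = 1 := by rw [e.symm_apply_eq, he1]
  rw [he1] at hlip hF
  -- Clamping the parameter makes γ Lipschitz on all of ℝ and constant after 1, as the difference
  -- quotients require.
  set γ : ℝ → 𝔼 d := fun s => (φ ∘ e.symm) (projIcc 0 1 zero_le_one s) with hγ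
  have hγe : EqOn γ (φ ∘ e.symm) (Icc 0 1) := fun s hs => by
    rw [hγ]; simp only [projIcc_of_mem zero_le_one hs]
  have hmem (s : ℝ) (hs : s ∈ Icc (0 : ℝ) 1) : e s ∈ Icc (0 : ℝ) 1 :=
    ⟨he0 ▸ e.monotone hs.1, he1 ▸ e.monotone hs.2⟩
  refine ⟨γ, ?_, ?_, ?_, fun s => ?_, ?_, e, ⟨e.continuous.continuousOn,
    e.monotone.monotoneOn _, he0, he1⟩, fun s hs => ?_⟩
  · have := hlip.to_restrict.comp (LipschitzWith.projIcc (zero_le_one' ℝ))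
    rwa [mul_one] at this
  · rw [hγe (by simp), Function.comp_apply, hs0]
  · rw [hγe (by simp), Function.comp_apply, hs1]
  · rw [hγe (projIcc 0 1 zero_le_one s).2]
  · rw [geomAction_congr b zero_le_one hγe]
    refine (hF fun y v => geomLagrangian v (b y)).trans
      (intervalIntegral.integral_congr fun s _ => ?_)
    have hw0 : 0 < w s := hℓ1.trans_le (hwδ s)
    simp only [geomLagrangian_smul (inv_nonneg.2 hw0.le), mul_inv_cancel_left₀ hw0.ne']
    rfl
  · rw [hγe (hmem s hs), Function.comp_apply, e.symm_apply_apply]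

/-- Arzelà–Ascoli: all values lie in the compact ball of radius C about the common starting point.
-/
theorem exists_subseq_tendstoUniformlyOn {C : ℝ≥0} {γ : ℕ → ℝ → 𝔼 d}
    (hγ : ∀ n, LipschitzWith C (γ n)) {p : 𝔼 d} (hp : ∀ n, γ n 0 = p) :
    ∃ g : ℝ → 𝔼 d, LipschitzWith C g ∧ (∀ s, g s = g (projIcc 0 1 zero_le_one s)) ∧
      ∃ k : ℕ → ℕ, StrictMono k ∧
        TendstoUniformlyOn (fun n => γ (k n)) g atTop (Icc 0 1) := by
  let f : ℕ → BoundedContinuousFunction (Icc (0 : ℝ) 1) (𝔼 d) := fun n =>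
    BoundedContinuousFunction.mkOfCompact
      ⟨fun s => γ n s, (hγ n).continuous.comp continuous_subtype_val⟩
  have hfγ (n : ℕ) (s : Icc (0 : ℝ) 1) : f n s = γ n s := rfl
  have hflip (n : ℕ) : LipschitzWith C (f n) := by
    have := (hγ n).comp (LipschitzWith.subtype_val (Icc (0 : ℝ) 1))
    rwa [mul_one] at this
  have hcpt : IsCompact (closure (range f)) := by
    refine BoundedContinuousFunction.arzela_ascoli (Metric.closedBall p C)
      (isCompact_closedBall p C) _ ?_ ?_
    · rintro _ s ⟨n, rfl⟩
      rw [hfγ, Metric.mem_closedBall, ← hp n]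
      refine ((hγ n).dist_le_mul _ _).trans (mul_le_of_le_one_right C.2 ?_)
      rw [Real.dist_eq, sub_zero, abs_of_nonneg s.2.1]
      exact s.2.2
    · refine (LipschitzWith.uniformEquicontinuous _ C ?_).equicontinuous
      rintro ⟨_, n, rfl⟩
      exact hflip n
  obtain ⟨g, -, k, hk, hlim⟩ := hcpt.tendsto_subseq fun n =>
    subset_closure (mem_range_self (f := f) n)
  have hunif := BoundedContinuousFunction.tendsto_iff_tendstoUniformly.1 hlim
  have hglip : LipschitzWith C g := by
    refine LipschitzWith.of_dist_le_mul fun s t => ?_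
    exact le_of_tendsto' ((hunif.tendsto_at s).dist (hunif.tendsto_at t)) fun n =>
      (hflip (k n)).dist_le_mul s t
  refine ⟨fun s => g (projIcc 0 1 zero_le_one s), ?_, fun s => ?_, k, hk, ?_⟩
  · have := hglip.comp (LipschitzWith.projIcc (zero_le_one' ℝ))
    rwa [mul_one] at this
  · beta_reduce
    rw [projIcc_val]
  · rw [Metric.tendstoUniformlyOn_iff]
    intro ε hε
    filter_upwards [Metric.tendstoUniformly_iff.1 hunif ε hε] with n hn s hs
    rw [projIcc_of_mem zero_le_one hs]
    exact hn ⟨s, hs⟩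

/-! ### The Fréchet distance -/

/-- Tests the infimum with the linear clock s ↦ Ts on the first curve and β on the second. -/
theorem frechetDist_comp_div_le {T : ℝ} (hT : 0 < T) {f g : ℝ → 𝔼 d} {β : ℝ → ℝ}
    (hβ : β ∈ reparam 1) {c : ℝ≥0∞} (h : ∀ s ∈ Icc (0 : ℝ) 1, edist (f s) (g (β s)) ≤ c) :
    frechetDist T (fun t => f (t / T)) 1 g ≤ c := by
  have hα : (fun s => T * s) ∈ reparam T :=
    ⟨by fun_prop, fun s _ t _ hst => mul_le_mul_of_nonneg_left hst hT.le, by simp, by simp⟩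
  refine (iInf₂_le _ hα).trans ((iInf₂_le β hβ).trans (iSup₂_le fun s hs => ?_))
  beta_reduce
  rw [mul_div_cancel_left₀ s hT.ne']
  exact h s hs

end MinAction

/-! ### Convergence of the constrained minimizers -/

theorem mainTheorem3 {d : ℕ}
    (b : EuclideanSpace ℝ (Fin d) → EuclideanSpace ℝ (Fin d))
    (hb : ∃ K : ℝ≥0, LipschitzWith K b)
    (D : Set (EuclideanSpace ℝ (Fin d))) (hD : MinAction.IsExitDomain b D)
    (x : EuclideanSpace ℝ (Fin d)) (hx : x ∈ frontier D)
    (N : ℕ) (φ : ℕ → ℝ → EuclideanSpace ℝ (Fin d))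
    (hφ : ∀ n, N ≤ n → MinAction.IsConstrainedMinimizer b 0 x n (φ n))
    (hlen : ∃ L : ℝ, ∀ n, N ≤ n →
      MinAction.curveLength (MinAction.optTime b (φ n)) (MinAction.timePath b (φ n)) ≤ L) :
    -- the constrained minimizers form a minimizing sequence, of `Ŝ` and of Problem II
    Tendsto (fun n => MinAction.optAction b (φ n)) atTop
        (𝓝 (sInf (MinAction.optAction b '' MinAction.admissible 0 x 1))) ∧
    Tendsto (fun n => MinAction.action b (MinAction.optTime b (φ n)) (MinAction.timePath b (φ n)))
        atTop (𝓝 (MinAction.quasiPotential b 0 x)) ∧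
    -- a subsequence converges in Fréchet distance to a minimizer
    ∃ φstar : ℝ → EuclideanSpace ℝ (Fin d),
      MinAction.ACPath 0 x 1 φstar ∧
      MinAction.geomAction b 1 φstar = MinAction.quasiPotential b 0 x ∧
      (∀ T : ℝ, 0 < T → ∀ ψ : ℝ → EuclideanSpace ℝ (Fin d), MinAction.ACPath 0 x T ψ →
        MinAction.geomAction b 1 φstar ≤ MinAction.geomAction b T ψ) ∧
      ∃ k : ℕ → ℕ, StrictMono k ∧ (∀ l, N ≤ k l) ∧
        Tendsto (fun l => MinAction.frechetDist
            (MinAction.optTime b (φ (k l))) (MinAction.timePath b (φ (k l))) 1 φstar)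
          atTop (𝓝 0) := by
  open MinAction in
  obtain ⟨K, hK⟩ := hb
  have hbc := hK.continuous
  obtain ⟨L, hL⟩ := hlen
  have hbx : b x ≠ 0 := by
    obtain ⟨ν, -, hν⟩ := hD.inward x hx
    intro h
    simp [h] at hν
  have h0x : (0 : EuclideanSpace ℝ (Fin d)) ≠ x := by
    rintro rfl
    exact (hD.isOpen.frontier_eq ▸ hx : _ ∈ closure D \ D).2 hD.zero_mem
  have hadm (n : ℕ) (hn : N ≤ n) : φ n ∈ admissible 0 x 1 := (hφ n hn).1
  have hlim := tendsto_optAction_constrainedMinimizer hbc h0x hbx hφ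
  refine ⟨?_, ?_, ?_⟩
  · rwa [sInf_optAction_eq_quasiPotential hbc h0x hbx (hadm N le_rfl)]
  · refine hlim.congr' ?_
    filter_upwards [eventually_ge_atTop N] with n hn
    exact (action_timePath hbc h0x hbx (hadm n hn)).symm
  have hshift (n : ℕ) : φ (N + n) ∈ admissible 0 x 1 := hadm _ (Nat.le_add_right N n)
  -- Physical-time length equals length on `[0, 1]`, so all the curves share the Lipschitz constant
  -- `L.toNNReal + 1`.
  choose γ hlip hγ0 hγ1 hproj hgeom β hβ hγβ using fun n =>
    exists_lipschitz_reparametrization b (hshift n).1.1 (L := L.toNNReal)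
      (((curveLength_timePath hbc h0x hbx (hshift n)).symm.trans_le
        (hL _ (Nat.le_add_right N n))).trans (Real.le_coe_toNNReal L))
  have hp (n : ℕ) : γ n 0 = 0 := (hγ0 n).trans (hshift n).1.2.1
  have hq (n : ℕ) : γ n 1 = x := (hγ1 n).trans (hshift n).1.2.2
  obtain ⟨g, hg, hgproj, k, hk, hunif⟩ := exists_subseq_tendstoUniformlyOn hlip hp
  have hpt (s : ℝ) : Tendsto (fun n => γ (k n) s) atTop (𝓝 (g s)) := by
    rw [hgproj s]
    simp_rw [hproj _ s]
    exact hunif.tendsto_at (projIcc 0 1 zero_le_one s).2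
  have hac : ACPath 0 x 1 g := by
    refine ⟨ac_of_lipschitzWith hg 0 1, ?_, ?_⟩
    · exact tendsto_nhds_unique (hpt 0) (by simp [hp])
    · exact tendsto_nhds_unique (hpt 1) (by simp [hq])
  have hidx : Tendsto (fun n => N + k n) atTop atTop :=
    tendsto_atTop_mono (fun n => Nat.le_add_left _ _) hk.tendsto_atTop
  have hle : geomAction b 1 g ≤ quasiPotential b 0 x := by
    refine geomAction_le_of_tendsto hK (fun n => hlip (k n)) hg (fun n s hs => ?_)
      (fun n => hp (k n)) hpt (hlim.comp hidx) fun n => ?_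
    · rw [hproj, projIcc_of_right_le _ hs]
    · rw [hgeom]
      exact geomAction_le_optAction hbc h0x hbx (hshift _)
  refine ⟨g, hac, hle.antisymm (quasiPotential_le_geomAction hbc zero_lt_one hac),
    fun T hT ψ hψ => hle.trans (quasiPotential_le_geomAction hbc hT hψ),
    fun n => N + k n, fun m n hmn => Nat.add_lt_add_left (hk hmn) N,
    fun n => Nat.le_add_right _ _, ?_⟩
  rw [ENNReal.tendsto_nhds_zero]
  intro ε hε
  -- Since γ ∘ β = φ on `[0, 1]`, the uniform distance of γ and g bounds the Fréchet distance.
  filter_upwards [EMetric.tendstoUniformlyOn_iff.1 hunif ε hε] with n hn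
  refine frechetDist_comp_div_le (optTime_pos hbc h0x hbx (hshift _)) (hβ (k n)) fun s hs => ?_
  have hβs : β (k n) s ∈ Icc (0 : ℝ) 1 := by
    obtain ⟨-, hm, h0, h1⟩ := hβ (k n)
    exact ⟨h0 ▸ hm (by simp) hs hs.1, h1 ▸ hm hs (by simp) hs.2⟩
  rw [← hγβ (k n) s hs, edist_comm]
  exact (hn _ hβs).le
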